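/- Let $M$ be a smooth, connected, compact (Hausdorff) manifold, possibly with boundary, such that $H_1(M;\mathbb Z)$ is free with basis $\Gamma_1,\dots,\Gamma_b$, and let $\eta_1,\dots,\eta_b$ be smooth closed one-forms on $M$ dual to this basis: $\int_{\Gamma_j}\eta_i=\delta_{ij}$. Let $\pi:\tilde M_a\to M$ be the universal Abelian cover, i.e. the connected covering space with $\pi_*\pi_1(\tilde M_a,\tilde p)=[\pi_1(M,\pi(\tilde p)),\pi_1(M,\pi(\tilde p))]$ for all $\tilde p$. Fix $\tilde p_0\in\tilde M_a$ and let $\tilde\iota:\tilde M_a\to\mathbb R^b$ be the Abel--Jacobi map, $\tilde\iota_i(\tilde p)=\int_\gamma\pi^*\eta_i$ for any smooth path $\gamma$ in $\tilde M_a$ from $\tilde p_0$ to $\tilde p$. Let $f:M\to M$ be continuous, let $A\in M_b(\mathbb Z)$ be the matrix of $f_*:H_1(M;\mathbb Z)\to H_1(M;\mathbb Z)$ in the basis $\Gamma_j$, and assume that no complex eigenvalue of $A$ is a root of unity. Let $\Phi_A:\mathbb T^b\to\mathbb T^b$, $\mathbb T^b=\mathbb R^b/\mathbb Z^b$, be the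 toral endomorphism induced by $A$. Let $\tilde f:\tilde M_a\to\tilde M_a$ be a lift of $f$. For $k\ge 1$ put $BF_k(A)=\mathbb Z^b/(A^k-I)\mathbb Z^b$. If $f^k(x)=x$ and $\tilde x$ is a lift of $x$, then $n=\tilde\iota\tilde f^k(\tilde x)-\tilde\iota(\tilde x)$ is in $\mathbb Z^b$; the displacement of $x$ is $D_k(x,f^k)=n+(A^k-I)\mathbb Z^b\in BF_k(A)$, and $\alpha(x)=(A^k-I)^{-1}n+\mathbb Z^b\in\mathbb T^b$; neither depends on the choice of $\tilde x$. If $\Phi_A^k(y)=y$ and $\tilde y\in\mathbb R^b$ is a lift of $y$, its displacement is $D_k(y,\Phi_A^k)=A^k\tilde y-\tilde y+(A^k-I)\mathbb Z^b\in BF_k(A)$. Say that $x\in M$ and $y\in\mathbb T^b$ globally shadow if there are lifts $\tilde x$ of $x$, $\tilde y$ of $y$ and $\tilde f$ of $f$, and a constant $K$, such that $\|\tilde\iota\tilde f^m(\tilde x)-A^m\tilde y\|\le K$ for all $m\in\mathbb N$. Let $k\ge1$, $f^k(x)=x$ and $\Phi_A^k(y)=y$. Then $D_k(x,f^k)=D_k(y,\Phi_A^k)$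 if and only if $\alpha(x)=y$, and in this case $x$ and $y$ globally shadow. (No expansion hypothesis on $A$ is needed.) -/

import Mathlib

open Set Topology CategoryTheory Manifold
open scoped ContDiff

universe u

namespace GlobalShadow

noncomputable section

/-! ### First homology -/

/-- The coefficient module `ℤ`, moved to the universe of the space. -/
abbrev coeffs : ModuleCat.{u} ℤ := ModuleCat.of ℤ (ULift.{u} ℤ)

/-- The singular chain complex of `X` with integer coefficients. -/
abbrev singularChains (X : Type u) [TopologicalSpace X] : ChainComplex (ModuleCat.{u} ℤ) ℕ :=
  ((AlgebraicTopology.singularChainComplexFunctor (ModuleCat.{u} ℤ)).obj coeffs).obj (TopCat.of X)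

/-- The first singular homology group `H₁(X; ℤ)`. -/
abbrev H1 (X : Type u) [TopologicalSpace X] : ModuleCat.{u} ℤ :=
  ((AlgebraicTopology.singularHomologyFunctor (ModuleCat.{u} ℤ) 1).obj coeffs).obj (TopCat.of X)

/-- The map `f_* : H₁(X; ℤ) → H₁(X; ℤ)` induced by a continuous map `f`. -/
def H1map {X : Type u} [TopologicalSpace X] (f : C(X, X)) : H1 X →ₗ[ℤ] H1 X :=
  (((AlgebraicTopology.singularHomologyFunctor (ModuleCat.{u} ℤ) 1).obj coeffs).map
    (TopCat.ofHom f)).hom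

/-- A path, viewed as a singular `1`-simplex. -/
def pathSimplex {X : Type u} [TopologicalSpace X] {x y : X} (γ : Path x y) :
    (TopCat.toSSet.obj (TopCat.of X)).obj (.op (SimplexCategory.mk 1)) :=
  (TopCat.toSSetObjEquiv (TopCat.of X) (.op (SimplexCategory.mk 1))).symm
    (γ.toContinuousMap.comp
      ⟨stdSimplexHomeomorphUnitInterval, stdSimplexHomeomorphUnitInterval.continuous⟩)

/-- A path, viewed as a singular `1`-chain. -/
def pathChain {X : Type u} [TopologicalSpace X] {x y : X} (γ : Path x y) :
    (singularChains X).X 1 :=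
  (SSet.ιChainComplex (R := coeffs.{u}) (TopCat.toSSet.obj (TopCat.of X)) (pathSimplex γ)).hom
    (ULift.up (1 : ℤ))

/-- The loop `γ` represents the homology class `a`: the singular `1`-chain `γ` is a cycle whose
homology class is `a`. -/
def Represents {X : Type u} [TopologicalSpace X] {x : X} (γ : Path x x) (a : H1 X) : Prop :=
  ∃ z : (singularChains X).cycles 1,
    ((singularChains X).iCycles 1).hom z = pathChain γ ∧
      ((singularChains X).homologyπ 1).hom z = a

/-! ### The universal Abelian cover -/

/-- `π : Ma → M` is a universal Abelian cover of `M`: a connected covering space whose fundamental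
group is the commutator subgroup of that of `M`; equivalently, it is the quotient of the universal
cover by the commutator subgroup. -/
structure IsUniversalAbelianCover {M Ma : Type*} [TopologicalSpace M] [TopologicalSpace Ma]
    (π : C(Ma, M)) : Prop where
  isCoveringMap : IsCoveringMap π
  surjective : Function.Surjective π
  pathConnected : PathConnectedSpace Ma
  range_eq : ∀ p : Ma, (FundamentalGroup.map π p).range = commutator (FundamentalGroup M (π p))

/-- `F` is a lift of `f` through `π`. -/
def IsLift {M Ma : Type*} [TopologicalSpace M] [TopologicalSpace Ma]
    (π : C(Ma, M)) (f : C(M, M)) (F : Ma → Ma) : Prop :=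
  Continuous F ∧ ∀ p, π (F p) = f (π p)

/-! ### Closed one-forms, their integrals, and the Abel-Jacobi map -/

section Forms

variable {E : Type*} [NormedAddCommGroup E] [NormedSpace ℝ E] {H : Type*} [TopologicalSpace H]
  (I : ModelWithCorners ℝ E H) {M : Type*} [TopologicalSpace M] [ChartedSpace H M]

/-- The expression of the one-form `η` in the preferred chart around `x`. -/
def chartForm (η : ∀ x : M, TangentSpace I x →L[ℝ] ℝ) (x : M) (z : E) : E →L[ℝ] ℝ :=
  (η ((extChartAt I x).symm z)).comp
    (mfderivWithin 𝓘(ℝ, E) I (extChartAt I x).symm (range I) z)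

/-- `η` is a smooth closed one-form: in charts its coefficients are smooth and `dη = 0`. -/
def IsClosedOneForm (η : ∀ x : M, TangentSpace I x →L[ℝ] ℝ) : Prop :=
  ∀ x : M, ContDiffOn ℝ ∞ (chartForm I η x) (extChartAt I x).target ∧
    ∀ z ∈ (extChartAt I x).target, ∀ v w : E,
      fderivWithin ℝ (chartForm I η x) (extChartAt I x).target z v w =
        fderivWithin ℝ (chartForm I η x) (extChartAt I x).target z w v

/-- The path `γ` in the manifold is smooth on `[0, 1]`. -/
def IsSmoothPath {x y : M} (γ : Path x y) : Prop :=
  ContMDiffOn 𝓘(ℝ, ℝ) I ∞ γ.extend (Icc 0 1)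

/-- The integral `∫_γ η = ∫₀¹ η(γ'(t)) dt`. -/
def pathIntegral (η : ∀ x : M, TangentSpace I x →L[ℝ] ℝ) {x y : M} (γ : Path x y) : ℝ :=
  ∫ t in (0 : ℝ)..1, η (γ.extend t) (mfderivWithin 𝓘(ℝ, ℝ) I γ.extend (Icc 0 1) t (1 : ℝ))

/-- `η(a) = r`: the integral of the closed one-form `η` over the homology class `a`, computed on a
smooth loop that represents `a`, is `r`. -/
def HasPeriod {M : Type u} [TopologicalSpace M] [ChartedSpace H M]
    (η : ∀ x : M, TangentSpace I x →L[ℝ] ℝ) (a : H1 M) (r : ℝ) : Prop :=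
  ∃ (x : M) (γ : Path x x), IsSmoothPath I γ ∧ Represents γ a ∧ pathIntegral I η γ = r

/-- The Abel-Jacobi map `Ma → ℝᵇ` with base point `p₀`: its `i`-th coordinate at `p` is the common
value of the integrals of (the lift of) `η i` along the smooth paths in the cover from `p₀`
to `p`. -/
def abelJacobi {Ma : Type*} [TopologicalSpace Ma] (π : C(Ma, M)) {b : ℕ}
    (η : Fin b → ∀ x : M, TangentSpace I x →L[ℝ] ℝ) (p₀ p : Ma) : Fin b → ℝ :=
  fun i => Classical.epsilon fun r : ℝ =>
    ∃ γ : Path p₀ p, IsSmoothPath I (γ.map π.continuous) ∧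
      pathIntegral I (η i) (γ.map π.continuous) = r

end Forms

/-! ### Toral endomorphisms -/

section Torus

variable {b : ℕ}

/-- The torus `𝕋ᵇ = ℝᵇ/ℤᵇ`. -/
abbrev Torus (b : ℕ) : Type := Fin b → AddCircle (1 : ℝ)

/-- The covering projection `ℝᵇ → 𝕋ᵇ`. -/
def torusProj (v : Fin b → ℝ) : Torus b := fun i => (v i : AddCircle (1 : ℝ))

theorem torusProj_surjective : Function.Surjective (torusProj (b := b)) := fun y =>
  ⟨fun i => (QuotientAddGroup.mk_surjective (y i)).choose,
    funext fun i => (QuotientAddGroup.mk_surjective (y i)).choose_spec⟩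

/-- The linear action of an integer matrix on `ℝᵇ`. -/
def linAct (A : Matrix (Fin b) (Fin b) ℤ) (v : Fin b → ℝ) : Fin b → ℝ :=
  (A.map (Int.cast : ℤ → ℝ)).mulVec v

/-- The toral endomorphism `Φ_A : 𝕋ᵇ → 𝕋ᵇ`. -/
def toralEnd (A : Matrix (Fin b) (Fin b) ℤ) (y : Torus b) : Torus b :=
  fun i => ∑ j, A i j • y j

theorem toralEnd_torusProj (A : Matrix (Fin b) (Fin b) ℤ) (v : Fin b → ℝ) :
    toralEnd A (torusProj v) = torusProj (linAct A v) := by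
  funext i
  have h : ∀ (s : Finset (Fin b)) (g : Fin b → ℝ),
      (((∑ j ∈ s, g j : ℝ)) : AddCircle (1 : ℝ)) = ∑ j ∈ s, ((g j : ℝ) : AddCircle (1 : ℝ)) :=
    fun s g => map_sum (QuotientAddGroup.mk' (AddSubgroup.zmultiples (1 : ℝ))) g s
  simp only [toralEnd, torusProj, linAct, Matrix.mulVec, dotProduct, Matrix.map_apply]
  rw [h]
  refine Finset.sum_congr rfl fun j _ => ?_
  rw [← zsmul_eq_mul]
  rfl

/-- No complex eigenvalue of `A` is a root of unity. -/
def NoRootOfUnityEigenvalue (A : Matrix (Fin b) (Fin b) ℤ) : Prop :=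
  ∀ (μ : ℂ) (m : ℕ), 0 < m → μ ^ m = 1 →
    ¬ Module.End.HasEigenvalue (Matrix.toLin' (A.map (Int.cast : ℤ → ℂ))) μ

end Torus

/-! ### Displacements in the Bowen-Franks group, the comparison map, and shadowing -/

section Displacement

variable {b : ℕ}

/-- The Bowen-Franks group `BF_k(A) = ℤᵇ/(Aᵏ - I)ℤᵇ`. -/
abbrev BowenFranks (A : Matrix (Fin b) (Fin b) ℤ) (k : ℕ) : Type :=
  (Fin b → ℤ) ⧸ LinearMap.range (Matrix.mulVecLin (A ^ k - 1))

variable {X Xa : Type*}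

/-- The translation of `p` under `F`, measured by `ι`. -/
def translation (ι : Xa → Fin b → ℝ) (F : Xa → Xa) (p : Xa) : Fin b → ℝ := ι (F p) - ι p

/-- The displacement `D_k(x, F) ∈ BF_k(A)` of `x ∈ X`, where `F` is a lift to `Xa` of a map that
fixes `x`: the class of the translation of a lift of `x` under `F`. This translation is a vector of
integers, so that taking floors just reads it as an element of `ℤᵇ`. -/
def displacement (A : Matrix (Fin b) (Fin b) ℤ) (k : ℕ) {π : Xa → X} (hπ : Function.Surjective π)
    (ι : Xa → Fin b → ℝ) (F : Xa → Xa) (x : X) : BowenFranks A k :=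
  Submodule.Quotient.mk fun i => ⌊translation ι F (Function.surjInv hπ x) i⌋

/-- The comparison map on lifts: the solution `v ∈ ℝᵇ` of `Aᵏ v = v + n`, where `n` is the
translation of `p` under `F`. -/
def alphaLift (A : Matrix (Fin b) (Fin b) ℤ) (k : ℕ) (ι : Xa → Fin b → ℝ) (F : Xa → Xa) (p : Xa) :
    Fin b → ℝ :=
  ((A.map (Int.cast : ℤ → ℝ)) ^ k - 1)⁻¹.mulVec (translation ι F p)

/-- The comparison map `α` from points `x` of period `k` to points of `𝕋ᵇ` of period `k`. -/
def alpha (A : Matrix (Fin b) (Fin b) ℤ) (k : ℕ) {π : Xa → X} (hπ : Function.Surjective π)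
    (ι : Xa → Fin b → ℝ) (F : Xa → Xa) (x : X) : Torus b :=
  torusProj (alphaLift A k ι F (Function.surjInv hπ x))

/-- The orbits of `p` under `F` and of `v` under `A` shadow: their Euclidean distance in `ℝᵇ` is
bounded. -/
def Shadow (A : Matrix (Fin b) (Fin b) ℤ) (ι : Xa → Fin b → ℝ) (F : Xa → Xa) (p : Xa)
    (v : Fin b → ℝ) : Prop :=
  ∃ K : ℝ, ∀ n : ℕ, dist (WithLp.toLp 2 (ι (F^[n] p))) (WithLp.toLp 2 ((linAct A)^[n] v)) ≤ K

/-- The orbits `(x, f)` and `(y, Φ_A)` globally shadow: some lifts of `x`, `y` and `f` shadow. -/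
def GloballyShadow [TopologicalSpace X] [TopologicalSpace Xa] (A : Matrix (Fin b) (Fin b) ℤ)
    (π : C(Xa, X)) (ι : Xa → Fin b → ℝ) (f : C(X, X)) (x : X) (y : Torus b) : Prop :=
  ∃ (F : Xa → Xa) (p : Xa) (v : Fin b → ℝ),
    IsLift π f F ∧ π p = x ∧ torusProj v = y ∧ Shadow A ι F p v

end Displacement

end

end GlobalShadow

/-!
A closed one-form has local primitives, unique up to locally constant functions. The germs of these
primitives form a covering of `M`, so that a primitive can be continued along every continuous
path; its total increment is the integral of the form along the path. This integral is invariant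
under homotopies relative to the endpoints, it vanishes on loops whose class is a commutator, and
it is a singular cocycle, hence factors through a homomorphism on `H₁(M; ℤ)`. For the forms `η i`
dual to the basis `Γ` these homomorphisms are the coordinates with respect to `Γ`.

Consequently, if `p` and `q` lie over the same point of `M`, then `ι q - ι p` is the integer
coordinate vector of the homology class of the projection of any path from `p` to `q`. A lift `F` of
`f` carries this class to its image under `f_*`, so that `ι (F q) - ι (F p) = A (ι q - ι p)`.

Since `Aᵏ - I` is injective on `ℝᵇ`, the vectors `n` and `m` of integers are congruent modulo
`(Aᵏ - I) ℤᵇ` if and only if `(Aᵏ - I)⁻¹ n` and `(Aᵏ - I)⁻¹ m` are congruent modulo `ℤᵇ`, and the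
latter is `y` when `m` is the translation of a lift of `y`. If `v = (Aᵏ - I)⁻¹ n`, where `n` is the
translation of `p` under `Fᵏ`, then the difference `ι (Fʲ p) - Aʲ v` is periodic in `j`, hence
bounded.
-/

namespace GlobalShadow

/-! ### Integration of closed one-forms along continuous paths -/

/-- A closed one-form on a topological space, given by primitives on the members of an open cover
(indexed by the points of the space) that differ by locally constant functions. This is all that is
needed to integrate it along continuous paths. -/
structure LocalPrimitives (X : Type*) [TopologicalSpace X] where
  nhd : X → Set X
  isOpen_nhd : ∀ i, IsOpen (nhd i)
  mem_nhd : ∀ i, i ∈ nhd i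
  prim : X → X → ℝ
  eventually_sub_eq : ∀ i j x, x ∈ nhd i → x ∈ nhd j →
    ∀ᶠ y in 𝓝 x, prim i y - prim j y = prim i x - prim j x

/-- The real numbers with the discrete topology, the fibre of the covering space of germs of
primitives of a closed one-form. -/
def DiscreteReal : Type := ℝ

/-- The identity map onto the discrete reals. -/
def DiscreteReal.of : ℝ → DiscreteReal := id

/-- The identity map from the discrete reals. -/
def DiscreteReal.toReal : DiscreteReal → ℝ := id

instance : TopologicalSpace DiscreteReal := ⊥
instance : DiscreteTopology DiscreteReal := ⟨rfl⟩

instance : ContractibleSpace unitInterval :=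
  (convex_Icc 0 1).contractibleSpace (nonempty_Icc.2 zero_le_one)

instance : LocallyPathConnectedSpace unitInterval :=
  (convex_Icc (0 : ℝ) 1).locallyPathConnectedSpace

namespace LocalPrimitives

variable {X : Type*} [TopologicalSpace X] (P : LocalPrimitives X)
  {T : Type*} [TopologicalSpace T] {T' : Type*} [TopologicalSpace T']

/-- `h` is a primitive along `σ` of the closed one-form with the local primitives `P`: near each
point, `h` differs by a constant from the pull-back under `σ` of a local primitive. -/
def IsPrimitiveAlong (σ : T → X) (h : T → ℝ) : Prop :=
  ∀ t i, σ t ∈ P.nhd i → ∀ᶠ s in 𝓝 t, h s - P.prim i (σ s) = h t - P.prim i (σ t)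

section Uniqueness

variable {P}

theorem IsPrimitiveAlong.comp {σ : T → X} {h : T → ℝ} (hh : P.IsPrimitiveAlong σ h) {φ : T' → T}
    (hφ : Continuous φ) : P.IsPrimitiveAlong (σ ∘ φ) (h ∘ φ) := fun t i hi =>
  hφ.continuousAt.eventually (hh (φ t) i hi)

theorem isPrimitiveAlong_const (x : X) (c : ℝ) :
    P.IsPrimitiveAlong (fun _ : T => x) fun _ => c := fun _ _ _ => .of_forall fun _ => rfl

theorem IsPrimitiveAlong.sub_eq_sub [PreconnectedSpace T] {σ : T → X} {h h' : T → ℝ}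
    (hh : P.IsPrimitiveAlong σ h) (hh' : P.IsPrimitiveAlong σ h') (s t : T) :
    h s - h t = h' s - h' t := by
  have hc : IsLocallyConstant fun t => h t - h' t := by
    rw [IsLocallyConstant.iff_eventually_eq]
    intro t
    filter_upwards [hh t _ (P.mem_nhd _), hh' t _ (P.mem_nhd _)] with s h₁ h₂
    linarith
  have := hc.apply_eq_of_preconnectedSpace s t
  linarith

end Uniqueness

/-- The covering space of germs of primitives. The coordinate of a germ at `x` over the `i`-th set
of the cover is its value at `x` minus the value of the `i`-th primitive. -/
def germBundleCore : FiberBundleCore X X DiscreteReal where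
  baseSet := P.nhd
  isOpen_baseSet := P.isOpen_nhd
  indexAt := id
  mem_baseSet_at := P.mem_nhd
  coordChange i j x v := .of (v.toReal + (P.prim i x - P.prim j x))
  coordChange_self i x _ v := by
    rw [sub_self, add_zero]
    rfl
  continuousOn_coordChange i j := by
    rintro ⟨x, v⟩ ⟨⟨hi, hj⟩, -⟩
    have hv : ∀ᶠ p : X × DiscreteReal in 𝓝 (x, v), p.2 = v :=
      continuous_snd.continuousAt.eventually_mem ((isOpen_discrete {v}).mem_nhds (mem_singleton v))
    have hx : ∀ᶠ p : X × DiscreteReal in 𝓝 (x, v),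
        P.prim i p.1 - P.prim j p.1 = P.prim i x - P.prim j x :=
      (continuous_fst.tendsto (x, v)).eventually (P.eventually_sub_eq i j x hi hj)
    refine (continuousAt_const
      (y := DiscreteReal.of (v.toReal + (P.prim i x - P.prim j x)))).congr ?_
      |>.continuousWithinAt
    filter_upwards [hv, hx] with p h₁ h₂
    rw [h₁, h₂]
  coordChange_comp i j k x _ v := by
    change v.toReal + (P.prim i x - P.prim j x) + (P.prim j x - P.prim k x) =
      v.toReal + (P.prim i x - P.prim k x)
    ring

theorem exists_isPrimitiveAlong [SimplyConnectedSpace T] [LocallyPathConnectedSpace T]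
    (σ : C(T, X)) : ∃ h : T → ℝ, P.IsPrimitiveAlong σ h := by
  let Z := P.germBundleCore
  have hcov : IsCoveringMap (Bundle.TotalSpace.proj : Bundle.TotalSpace DiscreteReal Z.Fiber → X) :=
    FiberBundle.isCoveringMap
  obtain ⟨t₀⟩ : Nonempty T := inferInstance
  obtain ⟨G, ⟨-, hG⟩, -⟩ := hcov.existsUnique_continuousMap_lifts σ t₀
    ⟨σ t₀, DiscreteReal.of 0⟩ rfl
  have hproj : ∀ t, (G t).1 = σ t := congrFun hG
  refine ⟨fun t => DiscreteReal.toReal (G t).2 + P.prim (σ t) (σ t), fun t i hi => ?_⟩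
  have hmem : G t ∈ (Z.localTriv i).source := by
    rw [Z.mem_localTriv_source, hproj]
    exact hi
  have hcont : ContinuousAt (fun s => (Z.localTriv i (G s)).2) t :=
    continuous_snd.continuousAt.comp
      (((Z.localTriv i).continuousAt hmem).comp G.continuous.continuousAt)
  filter_upwards [hcont.eventually_mem ((isOpen_discrete {(Z.localTriv i (G t)).2}).mem_nhds rfl)]
    with s hs
  have hcoord : DiscreteReal.toReal (G s).2 + (P.prim (G s).1 (G s).1 - P.prim i (G s).1) =
    DiscreteReal.toReal (G t).2 + (P.prim (G t).1 (G t).1 - P.prim i (G t).1) := hs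
  rw [hproj, hproj] at hcoord
  linarith

/-- The integral along a continuous path of the closed one-form with the local primitives `P`: the
increment of any primitive along the path. -/
noncomputable def integral (c : C(unitInterval, X)) : ℝ :=
  (P.exists_isPrimitiveAlong c).choose 1 - (P.exists_isPrimitiveAlong c).choose 0

variable {P} in
theorem IsPrimitiveAlong.integral_eq_sub {σ : T → X} {h : T → ℝ} (hh : P.IsPrimitiveAlong σ h)
    (φ : C(unitInterval, T)) {c : C(unitInterval, X)} (hc : ∀ t, c t = σ (φ t)) :
    P.integral c = h (φ 1) - h (φ 0) := by
  have hφ : P.IsPrimitiveAlong c (h ∘ φ) := funext hc ▸ hh.comp φ.continuous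
  exact (P.exists_isPrimitiveAlong c).choose_spec.sub_eq_sub hφ 1 0

theorem integral_const (x : X) : P.integral (.const unitInterval x) = 0 := by
  simpa using (isPrimitiveAlong_const (P := P) (T := unitInterval) x 0).integral_eq_sub (.id _)
    fun _ => rfl

theorem integral_symm {x y : X} (γ : Path x y) :
    P.integral γ.symm.toContinuousMap = -P.integral γ.toContinuousMap := by
  obtain ⟨h, hh⟩ := P.exists_isPrimitiveAlong γ.toContinuousMap
  rw [hh.integral_eq_sub (.id _) fun _ => rfl,
    hh.integral_eq_sub ⟨unitInterval.symm, unitInterval.continuous_symm⟩ fun _ => rfl]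
  simp

theorem integral_trans {x y z : X} (γ : Path x y) (γ' : Path y z) :
    P.integral (γ.trans γ').toContinuousMap =
      P.integral γ.toContinuousMap + P.integral γ'.toContinuousMap := by
  obtain ⟨h, hh⟩ := P.exists_isPrimitiveAlong (T := ℝ)
    ⟨(γ.trans γ').extend, (γ.trans γ').continuous_extend⟩
  have hfirst := hh.integral_eq_sub ⟨fun t : unitInterval => (t : ℝ) / 2, by fun_prop⟩
    (c := γ.toContinuousMap) fun t => by
      have ht : (t : ℝ) / 2 ≤ 1 / 2 := by linarith [t.2.2]
      simp [Path.extend_trans_of_le_half γ γ' ht, mul_div_cancel₀]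
  have hsecond := hh.integral_eq_sub ⟨fun t : unitInterval => ((t : ℝ) + 1) / 2, by fun_prop⟩
    (c := γ'.toContinuousMap) fun t => by
      have ht : 1 / 2 ≤ ((t : ℝ) + 1) / 2 := by linarith [t.2.1]
      simp [Path.extend_trans_of_half_le γ γ' ht, mul_div_cancel₀]
  have hwhole := hh.integral_eq_sub ⟨fun t : unitInterval => (t : ℝ), by fun_prop⟩
    (c := (γ.trans γ').toContinuousMap) fun t => by simp
  rw [hfirst, hsecond, hwhole]
  norm_num

theorem integral_eq_of_homotopic {x y : X} {γ γ' : Path x y} (hγ : γ.Homotopic γ') :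
    P.integral γ.toContinuousMap = P.integral γ'.toContinuousMap := by
  obtain ⟨G⟩ := hγ
  obtain ⟨h, hh⟩ := P.exists_isPrimitiveAlong G.toContinuousMap
  have hγ := hh.integral_eq_sub ⟨fun t => (0, t), by fun_prop⟩ (c := γ.toContinuousMap) (by simp)
  have hγ' := hh.integral_eq_sub ⟨fun t => (1, t), by fun_prop⟩ (c := γ'.toContinuousMap) (by simp)
  have hx := hh.integral_eq_sub ⟨fun s => (s, 0), by fun_prop⟩ (c := .const _ x) (by simp)
  have hy := hh.integral_eq_sub ⟨fun s => (s, 1), by fun_prop⟩ (c := .const _ y) (by simp)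
  simp only [integral_const, ContinuousMap.coe_mk] at hγ hγ' hx hy
  linarith

/-- The homomorphism from the fundamental group to the reals given by integration. -/
noncomputable def periodHom (x : X) : FundamentalGroup X x →* Multiplicative ℝ where
  toFun a := .ofAdd (Quotient.lift (fun γ : Path x x => P.integral γ.toContinuousMap)
    (fun _ _ => P.integral_eq_of_homotopic) a)
  map_one' := P.integral_const x
  map_mul' a b := by
    induction a using Quotient.inductionOn with | _ γ
    induction b using Quotient.inductionOn with | _ γ'
    exact (P.integral_trans γ' γ).trans (add_comm _ _)

section Cover

variable {Y : Type*} [TopologicalSpace Y] (π : C(Y, X)) {p : Y}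
  (hπ : (FundamentalGroup.map π p).range ≤ commutator (FundamentalGroup X (π p)))

include hπ

theorem integral_map_loop_eq_zero (γ : Path p p) :
    P.integral (γ.map π.continuous).toContinuousMap = 0 :=
  Abelianization.commutator_subset_ker (P.periodHom (π p)) (hπ ⟨⟦γ⟧, rfl⟩)

theorem integral_map_eq_integral_map {q : Y} (γ γ' : Path p q) :
    P.integral (γ.map π.continuous).toContinuousMap =
      P.integral (γ'.map π.continuous).toContinuousMap := by
  have h := P.integral_map_loop_eq_zero π hπ (γ.trans γ'.symm)
  rw [Path.map_trans, integral_trans, ← Path.map_symm, integral_symm] at h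
  linarith

end Cover

end LocalPrimitives

/-! ### Periods on first homology -/

section Homology

open Limits Simplicial

/-- The singular simplicial set of a topological space. -/
noncomputable abbrev singularSet (X : Type u) [TopologicalSpace X] : SSet.{u} :=
  TopCat.toSSet.obj (TopCat.of X)

/-- The chain complex of the singular simplicial set. It is `singularChains X` by definition, but
syntactically in the form for which the simplices and the differential are described. -/
noncomputable abbrev simplicialChains (X : Type u) [TopologicalSpace X] :
    ChainComplex (ModuleCat.{u} ℤ) ℕ :=
  (singularSet X).chainComplex coeffs.{u}

variable {X : Type u} [TopologicalSpace X]

section Cocycle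

variable {N : Type u} [AddCommGroup N] (c : singularSet X _⦋1⦌ → N)

/-- The homomorphism on singular `1`-chains with prescribed values on singular `1`-simplices. -/
noncomputable def cochain : (simplicialChains X).X 1 ⟶ ModuleCat.of ℤ N :=
  Cofan.IsColimit.desc (SSet.isColimitChainComplexXCofan (singularSet X) coeffs.{u} 1) fun σ =>
    ModuleCat.ofHom (LinearMap.toSpanSingleton ℤ N (c σ) ∘ₗ ULift.moduleEquiv.toLinearMap)

theorem ι_comp_cochain (σ : singularSet X _⦋1⦌) :
    SSet.ιChainComplex (R := coeffs.{u}) (singularSet X) σ ≫ cochain c =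
      ModuleCat.ofHom (LinearMap.toSpanSingleton ℤ N (c σ) ∘ₗ ULift.moduleEquiv.toLinearMap) :=
  Cofan.IsColimit.fac (SSet.isColimitChainComplexXCofan (singularSet X) coeffs.{u} 1) _ σ

theorem cochain_pathChain {x y : X} (γ : Path x y) :
    (cochain c).hom (pathChain γ) = c (pathSimplex γ) :=
  (ConcreteCategory.congr_hom (ι_comp_cochain c (pathSimplex γ)) (ULift.up 1)).trans
    (one_zsmul _)

/-- A function on singular `1`-simplices is a cocycle if its values on the faces of each singular
`2`-simplex have alternating sum zero. -/
def IsCocycle : Prop :=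
  ∀ σ : singularSet X _⦋2⦌,
    c ((singularSet X).δ 1 σ) = c ((singularSet X).δ 2 σ) + c ((singularSet X).δ 0 σ)

variable {c}

theorem IsCocycle.d_comp_cochain (hc : IsCocycle c) :
    (simplicialChains X).d 2 1 ≫ cochain c = 0 := by
  refine SSet.chainComplex_hom_ext fun σ => ?_
  rw [SSet.ιChainComplex_d_assoc, Preadditive.sum_comp, comp_zero, Fin.sum_univ_three]
  simp only [Preadditive.zsmul_comp, ι_comp_cochain, hc σ]
  ext
  simp

/-- The homomorphism on the first homology group induced by a cocycle. -/
noncomputable def IsCocycle.homologyHom (hc : IsCocycle c) : H1 X →ₗ[ℤ] N :=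
  ((simplicialChains X).homologyι 1 ≫
    (simplicialChains X).descOpcycles (cochain c) 2 (ChainComplex.prev ℕ 1) hc.d_comp_cochain).hom

theorem IsCocycle.homologyHom_eq (hc : IsCocycle c) {x : X} {γ : Path x x} {a : H1 X}
    (h : Represents γ a) : hc.homologyHom a = c (pathSimplex γ) := by
  obtain ⟨z, hz, rfl⟩ := h
  have hι : (simplicialChains X).homologyπ 1 ≫ (simplicialChains X).homologyι 1 ≫
      (simplicialChains X).descOpcycles (cochain c) 2 (ChainComplex.prev ℕ 1) hc.d_comp_cochain =
        (simplicialChains X).iCycles 1 ≫ cochain c := by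
    simp
  exact (ConcreteCategory.congr_hom hι z).trans
    ((congrArg (cochain c).hom hz).trans (cochain_pathChain c γ))

end Cocycle

/-- A singular `1`-simplex, viewed as a map on the unit interval. -/
noncomputable def edgeMap (σ : singularSet X _⦋1⦌) : C(unitInterval, X) :=
  (TopCat.toSSetObjEquiv (TopCat.of X) (.op ⦋1⦌) σ).comp stdSimplexHomeomorphUnitInterval.symm

theorem edgeMap_pathSimplex {x y : X} (γ : Path x y) :
    edgeMap (pathSimplex γ) = γ.toContinuousMap := by
  ext t
  simp [edgeMap, pathSimplex]

theorem stdSimplexHomeomorphUnitInterval_symm_zero :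
    stdSimplexHomeomorphUnitInterval.symm 0 = stdSimplex.vertex (S := ℝ) (0 : Fin 2) :=
  stdSimplexHomeomorphUnitInterval.symm_apply_eq.2 rfl

theorem stdSimplexHomeomorphUnitInterval_symm_one :
    stdSimplexHomeomorphUnitInterval.symm 1 = stdSimplex.vertex (S := ℝ) (1 : Fin 2) :=
  stdSimplexHomeomorphUnitInterval.symm_apply_eq.2 rfl

section Period

instance (n : ℕ) : ContractibleSpace (stdSimplex ℝ (Fin (n + 1))) :=
  (convex_stdSimplex ℝ _).contractibleSpace ⟨_, single_mem_stdSimplex ℝ 0⟩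

instance (n : ℕ) : LocallyPathConnectedSpace (stdSimplex ℝ (Fin n)) :=
  (convex_stdSimplex ℝ _).locallyPathConnectedSpace

namespace LocalPrimitives

variable (P : LocalPrimitives X)

theorem isCocycle_integral :
    IsCocycle fun σ : singularSet X _⦋1⦌ => ULift.up.{u} (P.integral (edgeMap σ)) := by
  intro σ
  obtain ⟨h, hh⟩ := P.exists_isPrimitiveAlong (TopCat.toSSetObjEquiv (TopCat.of X) (.op ⦋2⦌) σ)
  have hface (i : Fin 3) : P.integral (edgeMap ((singularSet X).δ i σ)) =
      h (stdSimplex.vertex (i.succAbove 1)) - h (stdSimplex.vertex (i.succAbove 0)) := by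
    have := hh.integral_eq_sub (c := edgeMap ((singularSet X).δ i σ))
      ⟨stdSimplex.map i.succAbove ∘ stdSimplexHomeomorphUnitInterval.symm,
        (stdSimplex.continuous_map _).comp stdSimplexHomeomorphUnitInterval.symm.continuous⟩
      fun _ => rfl
    simpa only [ContinuousMap.coe_mk, Function.comp_apply,
      stdSimplexHomeomorphUnitInterval_symm_one, stdSimplexHomeomorphUnitInterval_symm_zero,
      stdSimplex.map_vertex] using this
  ext
  simp only [ULift.add_down, hface]
  change h (stdSimplex.vertex 2) - h (stdSimplex.vertex 0) =
    h (stdSimplex.vertex 1) - h (stdSimplex.vertex 0) +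
      (h (stdSimplex.vertex 2) - h (stdSimplex.vertex 1))
  ring

/-- The homomorphism on the first homology group given by integration. -/
noncomputable def period : H1 X →ₗ[ℤ] ℝ :=
  ULift.moduleEquiv.toLinearMap ∘ₗ P.isCocycle_integral.homologyHom

theorem period_eq {x : X} {γ : Path x x} {a : H1 X} (h : Represents γ a) :
    P.period a = P.integral γ.toContinuousMap := by
  rw [← edgeMap_pathSimplex γ]
  exact congrArg ULift.down (P.isCocycle_integral.homologyHom_eq h)

end LocalPrimitives

end Period

theorem toSSetObjEquiv_pathSimplex_vertex {x y : X} (γ : Path x y) (i : Fin 2) :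
    TopCat.toSSetObjEquiv (TopCat.of X) (.op ⦋1⦌) (pathSimplex γ) (stdSimplex.vertex (S := ℝ) i) =
      ![x, y] i := by
  have h : TopCat.toSSetObjEquiv (TopCat.of X) (.op ⦋1⦌) (pathSimplex γ)
      (stdSimplex.vertex (S := ℝ) i) =
        γ (stdSimplexHomeomorphUnitInterval (stdSimplex.vertex (S := ℝ) i)) := by
    simp only [pathSimplex, Equiv.apply_symm_apply]
    rfl
  rw [h]
  fin_cases i
  · exact γ.source
  · exact γ.target

theorem δ_zero_pathSimplex {x : X} (γ : Path x x) :
    (singularSet X).δ 0 (pathSimplex γ) = (singularSet X).δ 1 (pathSimplex γ) := by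
  refine (TopCat.toSSetObjEquiv (TopCat.of X) (.op ⦋0⦌)).injective ?_
  ext z
  obtain rfl : z = stdSimplex.vertex (S := ℝ) (0 : Fin 1) := Subsingleton.elim _ _
  rw [TopCat.toSSetObjEquiv_δ_apply, TopCat.toSSetObjEquiv_δ_apply, stdSimplex.map_vertex,
    stdSimplex.map_vertex, toSSetObjEquiv_pathSimplex_vertex, toSSetObjEquiv_pathSimplex_vertex]
  rfl

theorem exists_represents {x : X} (γ : Path x x) : ∃ a : H1 X, Represents γ a := by
  have hd : SSet.ιChainComplex (R := coeffs.{u}) (singularSet X) (pathSimplex γ) ≫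
      (simplicialChains X).d 1 0 = 0 := by
    rw [SSet.ιChainComplex_d, Fin.sum_univ_two, δ_zero_pathSimplex]
    simp
  let l := (simplicialChains X).liftCycles _ 0 (ChainComplex.next_nat_succ 0) hd
  exact ⟨(simplicialChains X).homologyπ 1 (l (ULift.up 1)), l (ULift.up 1),
    ConcreteCategory.congr_hom
      ((simplicialChains X).liftCycles_i _ 0 (ChainComplex.next_nat_succ 0) hd) (ULift.up 1), rfl⟩

theorem Represents.map {x : X} {γ : Path x x} {a : H1 X} (h : Represents γ a) (f : C(X, X)) :
    Represents (γ.map f.continuous) (H1map f a) := by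
  obtain ⟨z, hz, rfl⟩ := h
  let φ := SSet.chainComplexMap (TopCat.toSSet.map (TopCat.ofHom f)) coeffs.{u}
  have hγ : (φ.f 1).hom (pathChain γ) = pathChain (γ.map f.continuous) :=
    ConcreteCategory.congr_hom (SSet.ι_chainComplexMap_f _ _
      (TopCat.toSSet.map (TopCat.ofHom f)) coeffs.{u} (pathSimplex γ)) (ULift.up 1)
  refine ⟨HomologicalComplex.cyclesMap φ 1 z, ?_, ?_⟩
  · exact (ConcreteCategory.congr_hom (HomologicalComplex.cyclesMap_i φ 1) z).trans
      ((congrArg (φ.f 1).hom hz).trans hγ)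
  · exact (ConcreteCategory.congr_hom (HomologicalComplex.homologyπ_naturality φ 1) z).symm

end Homology

/-! ### Primitives of closed one-forms on manifolds -/

section Forms

variable {E : Type*} [NormedAddCommGroup E] [NormedSpace ℝ E] {H : Type*} [TopologicalSpace H]
  (I : ModelWithCorners ℝ E H) {M : Type*} [TopologicalSpace M] [ChartedSpace H M]

section CoordinateBalls

/-- The ball of radius `ε` around the coordinates of `x` in the preferred chart, cut down to the
range of the model so that it is a convex set of coordinates also at the boundary. -/
def chartBall (x : M) (ε : ℝ) : Set E := Metric.ball (extChartAt I x x) ε ∩ range I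

/-- The points of the preferred chart at `x` whose coordinates have distance less than `ε` from
those of `x`. -/
def coordBall (x : M) (ε : ℝ) : Set M :=
  (extChartAt I x).source ∩ extChartAt I x ⁻¹' Metric.ball (extChartAt I x x) ε

variable {I} {x : M} {ε : ℝ}

theorem convex_chartBall : Convex ℝ (chartBall I x ε) := (convex_ball _ _).inter I.convex_range

theorem uniqueDiffOn_chartBall : UniqueDiffOn ℝ (chartBall I x ε) := by
  rw [chartBall, inter_comm]
  exact I.uniqueDiffOn.inter Metric.isOpen_ball

theorem chartBall_mem_nhdsWithin {z : E} (hz : z ∈ chartBall I x ε) :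
    chartBall I x ε ∈ 𝓝[range I] z :=
  Filter.inter_mem (mem_nhdsWithin_of_mem_nhds (Metric.isOpen_ball.mem_nhds hz.1))
    self_mem_nhdsWithin

theorem mem_chartBall_self (hε : 0 < ε) : extChartAt I x x ∈ chartBall I x ε :=
  ⟨Metric.mem_ball_self hε, mem_range_self _⟩

theorem exists_chartBall_subset {U : Set M} (hU : U ∈ 𝓝 x) :
    ∃ ε > 0, ∀ z ∈ chartBall I x ε, z ∈ (extChartAt I x).target ∧ (extChartAt I x).symm z ∈ U := by
  have hsymm := continuousAt_extChartAt_symm (I := I) x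
  rw [ContinuousAt, extChartAt_to_inv] at hsymm
  exact Metric.mem_nhdsWithin_iff.1 (Filter.Eventually.and (extChartAt_target_mem_nhdsWithin x)
    (nhdsWithin_le_nhds (hsymm.eventually hU)))

theorem isOpen_coordBall : IsOpen (coordBall I x ε) :=
  isOpen_extChartAt_preimage' x Metric.isOpen_ball

theorem mem_coordBall_self (hε : 0 < ε) : x ∈ coordBall I x ε :=
  ⟨mem_extChartAt_source x, Metric.mem_ball_self hε⟩

theorem extChartAt_mem_chartBall {p : M} (hp : p ∈ coordBall I x ε) :
    extChartAt I x p ∈ chartBall I x ε :=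
  ⟨hp.2, extChartAt_target_subset_range x ((extChartAt I x).map_source hp.1)⟩

end CoordinateBalls

section Primitives

variable {I} {η : ∀ x : M, TangentSpace I x →L[ℝ] ℝ} {x : M}

theorem IsClosedOneForm.exists_hasFDerivWithinAt_chartForm (hη : IsClosedOneForm I η) {ε : ℝ}
    (hε : chartBall I x ε ⊆ (extChartAt I x).target) :
    ∃ G : E → ℝ, ContDiffOn ℝ 1 G (chartBall I x ε) ∧
      ∀ z ∈ chartBall I x ε, HasFDerivWithinAt G (chartForm I η x z) (range I) z := by
  have hsmooth : ContDiffOn ℝ ∞ (chartForm I η x) (chartBall I x ε) := (hη x).1.mono hε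
  have hderiv : ∀ z ∈ chartBall I x ε, fderivWithin ℝ (chartForm I η x) (chartBall I x ε) z =
      fderivWithin ℝ (chartForm I η x) (extChartAt I x).target z := fun z hz =>
    fderivWithin_subset hε (uniqueDiffOn_chartBall z hz)
      ((hη x).1.differentiableOn (by simp) z (hε hz))
  obtain ⟨G, hG⟩ := convex_chartBall.exists_forall_hasFDerivWithinAt_of_fderivWithin_symmetric
    (hsmooth.differentiableOn (by simp)) fun z hz v _ w _ => by
      rw [hderiv z hz]
      exact (hη x).2 z (hε hz) v w
  refine ⟨G, contDiffOn_succ_of_fderivWithin (n := 0)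
    (fun z hz => (hG z hz).differentiableWithinAt) (by simp) (contDiffOn_zero.2 ?_),
    fun z hz => (hG z hz).mono_of_mem_nhdsWithin (chartBall_mem_nhdsWithin hz)⟩
  exact hsmooth.continuousOn.congr fun z hz => (hG z hz).fderivWithin (uniqueDiffOn_chartBall z hz)

variable [IsManifold I ∞ M]

theorem eventually_eq_of_hasMFDerivAt_zero {d : M → ℝ}
    (hd : ∀ᶠ p in 𝓝 x, HasMFDerivAt I 𝓘(ℝ, ℝ) d p 0) : ∀ᶠ p in 𝓝 x, d p = d x := by
  obtain ⟨ε, hε, hball⟩ := exists_chartBall_subset (I := I) hd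
  have hder : ∀ z ∈ chartBall I x ε,
      HasFDerivWithinAt (d ∘ (extChartAt I x).symm) (0 : E →L[ℝ] ℝ) (chartBall I x ε) z := by
    intro z hz
    have hcomp := (hball z hz).2.comp_hasMFDerivWithinAt z
      (mdifferentiableWithinAt_extChartAt_symm (I := I) (hball z hz).1).hasMFDerivWithinAt
    exact ((hasMFDerivWithinAt_iff_hasFDerivWithinAt.1 hcomp).mono inter_subset_right).congr_fderiv
      (ContinuousLinearMap.zero_comp _)
  filter_upwards [isOpen_coordBall.mem_nhds (mem_coordBall_self (I := I) hε)] with p hp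
  have hconst := convex_chartBall.norm_image_sub_le_of_norm_hasFDerivWithin_le hder (C := 0)
    (by simp) (mem_chartBall_self hε) (extChartAt_mem_chartBall hp)
  rwa [zero_mul, norm_le_zero_iff, sub_eq_zero, Function.comp_apply, Function.comp_apply,
    (extChartAt I x).left_inv hp.1, extChartAt_to_inv] at hconst

variable (η) in
theorem chartForm_comp_mfderiv_extChartAt {p : M} (hp : p ∈ (extChartAt I x).source) :
    (chartForm I η x (extChartAt I x p)).comp (mfderiv I 𝓘(ℝ, E) (extChartAt I x) p) = η p := by
  -- `η q` and `η p` have different types, so that `left_inv` cannot be used for rewriting.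
  have heval : ∀ q : M, q = p → ∀ v : E, η q v = η p v := by
    rintro q rfl v
    rfl
  ext v
  exact (heval _ ((extChartAt I x).left_inv hp) _).trans (congrArg (η p)
    (DFunLike.congr_fun (mfderivWithin_extChartAt_symm_comp_mfderiv_extChartAt' hp) v))

theorem hasMFDerivAt_comp_extChartAt {G : E → ℝ} {p : M} (hp : p ∈ (extChartAt I x).source)
    (hG : HasFDerivWithinAt G (chartForm I η x (extChartAt I x p)) (range I) (extChartAt I x p)) :
    HasMFDerivAt I 𝓘(ℝ, ℝ) (G ∘ extChartAt I x) p (η p) := by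
  have hchart : HasMFDerivAt I 𝓘(ℝ, E) (extChartAt I x) p (mfderiv I 𝓘(ℝ, E) (extChartAt I x) p) :=
    (mdifferentiableAt_extChartAt (by simpa using hp)).hasMFDerivAt
  have hcomp := hG.hasMFDerivWithinAt.comp p
    (hchart.hasMFDerivWithinAt (s := (extChartAt I x).source)) fun q hq =>
      extChartAt_target_subset_range x ((extChartAt I x).map_source hq)
  exact (hcomp.hasMFDerivAt ((isOpen_extChartAt_source x).mem_nhds hp)).congr_mfderiv
    (chartForm_comp_mfderiv_extChartAt η hp)

variable (I η) in
/-- `g` is a primitive of the one-form `η` on the open set `U`. -/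
structure IsPrimitiveOn (g : M → ℝ) (U : Set M) : Prop where
  isOpen : IsOpen U
  contMDiffOn : ContMDiffOn I 𝓘(ℝ, ℝ) 1 g U
  hasMFDerivAt : ∀ p ∈ U, HasMFDerivAt I 𝓘(ℝ, ℝ) g p (η p)

theorem IsPrimitiveOn.eventually_sub_eq {g g' : M → ℝ} {U U' : Set M}
    (hg : IsPrimitiveOn I η g U) (hg' : IsPrimitiveOn I η g' U') (hx : x ∈ U) (hx' : x ∈ U') :
    ∀ᶠ p in 𝓝 x, g p - g' p = g x - g' x := by
  refine eventually_eq_of_hasMFDerivAt_zero (I := I) (d := g - g') ?_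
  filter_upwards [hg.isOpen.mem_nhds hx, hg'.isOpen.mem_nhds hx'] with p hp hp'
  exact ((hg.hasMFDerivAt p hp).sub (hg'.hasMFDerivAt p hp')).congr_mfderiv (sub_self (η p))

theorem IsClosedOneForm.exists_isPrimitiveOn (hη : IsClosedOneForm I η) (x : M) :
    ∃ (U : Set M) (g : M → ℝ), x ∈ U ∧ IsPrimitiveOn I η g U := by
  obtain ⟨ε, hε, hball⟩ := exists_chartBall_subset (I := I) (x := x) Filter.univ_mem
  obtain ⟨G, hG, hder⟩ := hη.exists_hasFDerivWithinAt_chartForm fun z hz => (hball z hz).1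
  refine ⟨coordBall I x ε, G ∘ extChartAt I x, mem_coordBall_self hε, isOpen_coordBall, ?_,
    fun p hp => hasMFDerivAt_comp_extChartAt hp.1 (hder _ (extChartAt_mem_chartBall hp))⟩
  refine hG.contMDiffOn.comp ((contMDiffOn_extChartAt (n := 1)).mono fun p hp => ?_)
    fun p hp => extChartAt_mem_chartBall hp
  exact extChartAt_source I x ▸ hp.1

variable (I η) in
/-- The local primitives `P` are primitives of the one-form `η` on the manifold `M`. -/
def LocalPrimitives.IsPrimitiveOf (P : LocalPrimitives M) : Prop :=
  ∀ i, IsPrimitiveOn I η (P.prim i) (P.nhd i)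

theorem IsClosedOneForm.exists_localPrimitives (hη : IsClosedOneForm I η) :
    ∃ P : LocalPrimitives M, P.IsPrimitiveOf I η := by
  choose U g hU hg using hη.exists_isPrimitiveOn
  exact ⟨{ nhd := U
           isOpen_nhd i := (hg i).isOpen
           mem_nhd := hU
           prim := g
           eventually_sub_eq i j _ hi hj := (hg i).eventually_sub_eq (hg j) hi hj }, hg⟩

end Primitives

section PathIntegral

variable {I} {η : ∀ x : M, TangentSpace I x →L[ℝ] ℝ} {P : LocalPrimitives M}

theorem LocalPrimitives.IsPrimitiveAlong.exists_eventuallyEq_prim_add {T : Type*}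
    [TopologicalSpace T] {σ : T → M} {h : T → ℝ} (hh : P.IsPrimitiveAlong σ h) (t : T) :
    ∃ c, h =ᶠ[𝓝 t] fun s => P.prim (σ t) (σ s) + c := by
  refine ⟨h t - P.prim (σ t) (σ t), ?_⟩
  filter_upwards [hh t _ (P.mem_nhd _)] with s hs
  linarith

theorem LocalPrimitives.IsPrimitiveOf.hasDerivWithinAt (hP : P.IsPrimitiveOf I η) {c : ℝ → M}
    {h : ℝ → ℝ} (hh : P.IsPrimitiveAlong c h) {s : Set ℝ} {t : ℝ}
    (hc : MDifferentiableWithinAt 𝓘(ℝ, ℝ) I c s t) :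
    HasDerivWithinAt h (η (c t) (mfderivWithin 𝓘(ℝ, ℝ) I c s t (1 : ℝ))) s t := by
  obtain ⟨a, ha⟩ := hh.exists_eventuallyEq_prim_add t
  have hcomp := ((hP (c t)).hasMFDerivAt (c t) (P.mem_nhd _)).comp_hasMFDerivWithinAt t
    hc.hasMFDerivWithinAt
  have hder : HasFDerivWithinAt (P.prim (c t) ∘ c)
      ((show E →L[ℝ] ℝ from η (c t)).comp
        (show ℝ →L[ℝ] E from mfderivWithin 𝓘(ℝ, ℝ) I c s t)) s t :=
    hasMFDerivWithinAt_iff_hasFDerivWithinAt.1 hcomp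
  exact (hder.hasDerivWithinAt.add_const a).congr_of_eventuallyEq
    (ha.filter_mono nhdsWithin_le_nhds) ha.self_of_nhds

theorem LocalPrimitives.IsPrimitiveOf.contDiffOn (hP : P.IsPrimitiveOf I η) {c : ℝ → M}
    {h : ℝ → ℝ} (hh : P.IsPrimitiveAlong c h) {s : Set ℝ} (hc : ContMDiffOn 𝓘(ℝ, ℝ) I 1 c s) :
    ContDiffOn ℝ 1 h s := by
  intro t ht
  obtain ⟨a, ha⟩ := hh.exists_eventuallyEq_prim_add t
  have hcomp := ((hP (c t)).contMDiffOn.contMDiffAt ((P.isOpen_nhd _).mem_nhds (P.mem_nhd _)))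
    |>.comp_contMDiffWithinAt t (hc t ht)
  exact (hcomp.contDiffWithinAt.add contDiffWithinAt_const).congr_of_eventuallyEq
    (ha.filter_mono nhdsWithin_le_nhds) ha.self_of_nhds

theorem LocalPrimitives.IsPrimitiveOf.pathIntegral_eq (hP : P.IsPrimitiveOf I η) {x y : M}
    {γ : Path x y} (hγ : IsSmoothPath I γ) :
    pathIntegral I η γ = P.integral γ.toContinuousMap := by
  obtain ⟨h, hh⟩ := P.exists_isPrimitiveAlong (T := ℝ) ⟨γ.extend, γ.continuous_extend⟩
  rw [hh.integral_eq_sub ⟨fun t : unitInterval => (t : ℝ), by fun_prop⟩ (by simp)]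
  refine Eq.trans ?_ (intervalIntegral.integral_derivWithin_Icc_of_contDiffOn_Icc
    (hP.contDiffOn hh (hγ.of_le (by simp))) zero_le_one)
  refine intervalIntegral.integral_congr fun t ht => ?_
  rw [uIcc_of_le zero_le_one] at ht
  exact ((hP.hasDerivWithinAt hh ((hγ t ht).mdifferentiableWithinAt (by simp))).derivWithin
    (uniqueDiffOn_Icc zero_lt_one t ht)).symm

end PathIntegral

end Forms

/-! ### Smooth curves in a covering space -/

section SmoothlyJoined

variable {Y : Type*}

/-- The concatenation of the curves `c`, which stops at time `1`, and `c'`, which starts at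
time `0`. It runs through both at triple speed and rests in between, so that near each time it is a
reparametrisation of one of them. -/
noncomputable def concat (c c' : ℝ → Y) (t : ℝ) : Y :=
  if t ≤ 1 / 2 then c (3 * t) else c' (3 * t - 2)

section Concat

variable {c c' : ℝ → Y} {q : Y} (hc : ∀ t, 1 ≤ t → c t = q) (hc' : ∀ t ≤ 0, c' t = q)

include hc hc'

theorem concat_of_lt {t : ℝ} (ht : t < 2 / 3) : concat c c' t = c (3 * t) := by
  by_cases h : t ≤ 1 / 2
  · exact if_pos h
  · rw [concat, if_neg h, hc' _ (by linarith), hc _ (by linarith)]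

theorem concat_of_gt {t : ℝ} (ht : 1 / 3 < t) : concat c c' t = c' (3 * t - 2) := by
  by_cases h : t ≤ 1 / 2
  · rw [concat, if_pos h, hc' _ (by linarith), hc _ (by linarith)]
  · exact if_neg h

theorem concat_eventuallyEq (t : ℝ) :
    concat c c' =ᶠ[𝓝 t] (fun s => c (3 * s)) ∨ concat c c' =ᶠ[𝓝 t] fun s => c' (3 * s - 2) := by
  rcases lt_or_ge t (2 / 3) with ht | ht
  · exact .inl (Filter.mem_of_superset (Iio_mem_nhds ht) fun _ => concat_of_lt hc hc')
  · exact .inr (Filter.mem_of_superset (Ioi_mem_nhds (by linarith : 1 / 3 < t))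
      fun _ => concat_of_gt hc hc')

end Concat

variable [TopologicalSpace Y] {E : Type*} [NormedAddCommGroup E] [NormedSpace ℝ E] {H : Type*}
  [TopologicalSpace H] (I : ModelWithCorners ℝ E H) {M : Type*} [TopologicalSpace M]
  [ChartedSpace H M] {π : Y → M} {p q r : Y}

/-- The points `p` and `q` are joined by a curve with smooth projection. The curve rests before time
`0` and after time `1`, so that concatenation preserves smoothness. -/
def SmoothlyJoined (π : Y → M) (p q : Y) : Prop :=
  ∃ c : ℝ → Y, Continuous c ∧ (∀ t ≤ 0, c t = p) ∧ (∀ t, 1 ≤ t → c t = q) ∧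
    ContMDiff 𝓘(ℝ, ℝ) I ∞ (π ∘ c)

variable {I}

theorem SmoothlyJoined.symm (h : SmoothlyJoined I π p q) : SmoothlyJoined I π q p := by
  obtain ⟨c, hc, hp, hq, hs⟩ := h
  exact ⟨fun t => c (1 - t), by fun_prop, fun t ht => hq _ (by linarith),
    fun t ht => hp _ (by linarith),
    hs.comp (contMDiff_iff_contDiff.2 (by fun_prop : ContDiff ℝ ∞ fun t : ℝ => 1 - t))⟩

theorem SmoothlyJoined.trans (h : SmoothlyJoined I π p q) (h' : SmoothlyJoined I π q r) :
    SmoothlyJoined I π p r := by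
  obtain ⟨c, hc, hp, hq, hs⟩ := h
  obtain ⟨c', hc', hq', hr, hs'⟩ := h'
  refine ⟨concat c c', continuous_iff_continuousAt.2 fun t => ?_, fun t ht => ?_, fun t ht => ?_,
    fun t => ?_⟩
  · rcases concat_eventuallyEq hq hq' t with h | h <;>
      exact ContinuousAt.congr (by fun_prop) h.symm
  · rw [concat_of_lt hq hq' (by linarith), hp _ (by linarith)]
  · rw [concat_of_gt hq hq' (by linarith), hr _ (by linarith)]
  · rcases concat_eventuallyEq hq hq' t with h | h
    · exact (hs.comp (contMDiff_iff_contDiff.2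
        (by fun_prop : ContDiff ℝ ∞ fun t : ℝ => 3 * t))).contMDiffAt.congr_of_eventuallyEq
          (h.fun_comp π)
    · exact (hs'.comp (contMDiff_iff_contDiff.2
        (by fun_prop : ContDiff ℝ ∞ fun t : ℝ => 3 * t - 2))).contMDiffAt.congr_of_eventuallyEq
          (h.fun_comp π)

/-- A smooth parametrisation of the segment from `v` to `w` that rests before time `0` and after
time `1`. -/
noncomputable def smoothSegment (v w : E) (t : ℝ) : E :=
  AffineMap.lineMap v w (Real.smoothTransition t)

theorem contDiff_smoothSegment (v w : E) : ContDiff ℝ ∞ (smoothSegment v w) := by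
  unfold smoothSegment
  simp only [AffineMap.lineMap_apply_module']
  exact (Real.smoothTransition.contDiff.smul contDiff_const).add contDiff_const

theorem smoothSegment_of_nonpos (v w : E) {t : ℝ} (ht : t ≤ 0) : smoothSegment v w t = v := by
  rw [smoothSegment, Real.smoothTransition.zero_of_nonpos ht, AffineMap.lineMap_apply_zero]

theorem smoothSegment_of_one_le (v w : E) {t : ℝ} (ht : 1 ≤ t) : smoothSegment v w t = w := by
  rw [smoothSegment, Real.smoothTransition.one_of_one_le ht, AffineMap.lineMap_apply_one]

theorem smoothSegment_mem {s : Set E} (hs : Convex ℝ s) {v w : E} (hv : v ∈ s) (hw : w ∈ s)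
    (t : ℝ) : smoothSegment v w t ∈ s :=
  hs.lineMap_mem hv hw ⟨Real.smoothTransition.nonneg t, Real.smoothTransition.le_one t⟩

variable [IsManifold I ∞ M]

theorem eventually_smoothlyJoined (hπ : IsLocalHomeomorph π) (p : Y) :
    ∀ᶠ q in 𝓝 p, SmoothlyJoined I π p q := by
  obtain ⟨φ, hp, rfl⟩ := hπ p
  obtain ⟨ε, hε, hball⟩ :=
    exists_chartBall_subset (I := I) (φ.open_target.mem_nhds (φ.map_source hp))
  filter_upwards [φ.open_source.mem_nhds hp, (φ.continuousAt hp).preimage_mem_nhds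
    (isOpen_coordBall.mem_nhds (mem_coordBall_self (I := I) hε))] with q hq hφq
  let z : ℝ → E := smoothSegment (extChartAt I (φ p) (φ p)) (extChartAt I (φ p) (φ q))
  have hz : ContDiff ℝ ∞ z := contDiff_smoothSegment _ _
  have hzball (t : ℝ) := hball (z t) <| smoothSegment_mem convex_chartBall (mem_chartBall_self hε)
    (extChartAt_mem_chartBall hφq) t
  refine ⟨fun t => φ.symm ((extChartAt I (φ p)).symm (z t)), ?_, fun t ht => ?_, fun t ht => ?_, ?_⟩
  · exact φ.continuousOn_symm.comp_continuous ((continuousOn_extChartAt_symm (φ p)).comp_continuous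
      hz.continuous fun t => (hzball t).1) fun t => (hzball t).2
  · simp only [z, smoothSegment_of_nonpos _ _ ht, extChartAt_to_inv, φ.left_inv hp]
  · simp only [z, smoothSegment_of_one_le _ _ ht, (extChartAt I (φ p)).left_inv hφq.1,
      φ.left_inv hq]
  · have hcomp : φ ∘ (fun t => φ.symm ((extChartAt I (φ p)).symm (z t))) =
        (extChartAt I (φ p)).symm ∘ z := funext fun t => φ.right_inv (hzball t).2
    rw [hcomp]
    exact (contMDiffOn_extChartAt_symm (φ p)).comp_contMDiff hz.contMDiff fun t => (hzball t).1

theorem smoothlyJoined [PreconnectedSpace Y] (hπ : IsLocalHomeomorph π) (p q : Y) :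
    SmoothlyJoined I π p q :=
  have : Std.Symm (SmoothlyJoined I π) := ⟨fun _ _ => SmoothlyJoined.symm⟩
  PreconnectedSpace.induction₂ (SmoothlyJoined I π) (eventually_smoothlyJoined hπ)
    ⟨fun _ _ _ => SmoothlyJoined.trans⟩ p q

theorem exists_isSmoothPath_map [PreconnectedSpace Y] {π : C(Y, M)} (hπ : IsLocalHomeomorph π)
    (p q : Y) : ∃ γ : Path p q, IsSmoothPath I (γ.map π.continuous) := by
  obtain ⟨c, hc, hp, hq, hs⟩ := smoothlyJoined (I := I) hπ p q
  refine ⟨⟨⟨fun t => c t, by fun_prop⟩, hp _ (by simp), hq _ (by simp)⟩, ?_⟩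
  refine hs.contMDiffOn.congr fun t ht => ?_
  rw [Path.extend_apply _ ht]
  rfl

end SmoothlyJoined

/-! ### Translations of the Abel-Jacobi map -/

section AbelJacobi

variable {E : Type*} [NormedAddCommGroup E] [NormedSpace ℝ E] {H : Type*} [TopologicalSpace H]
  {I : ModelWithCorners ℝ E H} {M : Type u} [TopologicalSpace M] [ChartedSpace H M]
  {b : ℕ} {η : Fin b → ∀ x : M, TangentSpace I x →L[ℝ] ℝ} {P : Fin b → LocalPrimitives M}

theorem period_eq_repr {Γ : Module.Basis (Fin b) ℤ (H1 M)}
    (hP : ∀ i, (P i).IsPrimitiveOf I (η i))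
    (hdual : ∀ i j, HasPeriod I (η i) (Γ j) (if i = j then 1 else 0)) (a : H1 M) (i : Fin b) :
    (P i).period a = Γ.repr a i := by
  have hΓ (j : Fin b) : (P i).period (Γ j) = if i = j then 1 else 0 := by
    obtain ⟨x, γ, hγ, hr, h⟩ := hdual i j
    rw [(P i).period_eq hr, ← (hP i).pathIntegral_eq hγ, h]
  conv_lhs => rw [← Γ.sum_repr a, map_sum]
  simp [hΓ]

variable [IsManifold I ∞ M] {Ma : Type*} [TopologicalSpace Ma] [PathConnectedSpace Ma]
  {π : C(Ma, M)} (hloc : IsLocalHomeomorph π) {p₀ : Ma}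
  (hab : (FundamentalGroup.map π p₀).range ≤ commutator (FundamentalGroup M (π p₀)))

include hloc hab

theorem abelJacobi_eq_integral (hP : ∀ i, (P i).IsPrimitiveOf I (η i)) {p : Ma} (γ : Path p₀ p)
    (i : Fin b) :
    abelJacobi I π η p₀ p i = (P i).integral (γ.map π.continuous).toContinuousMap := by
  obtain ⟨δ, hδ⟩ := exists_isSmoothPath_map (I := I) hloc p₀ p
  obtain ⟨δ', hδ', h⟩ := Classical.epsilon_spec (p := fun r : ℝ =>
    ∃ γ : Path p₀ p, IsSmoothPath I (γ.map π.continuous) ∧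
      pathIntegral I (η i) (γ.map π.continuous) = r) ⟨_, δ, hδ, rfl⟩
  exact h.symm.trans (((hP i).pathIntegral_eq hδ').trans
    ((P i).integral_map_eq_integral_map π hab δ' γ))

theorem abelJacobi_sub_eq_integral (hP : ∀ i, (P i).IsPrimitiveOf I (η i)) {p q : Ma}
    (σ : Path p q) (i : Fin b) :
    abelJacobi I π η p₀ q i - abelJacobi I π η p₀ p i =
      (P i).integral (σ.map π.continuous).toContinuousMap := by
  let γ := PathConnectedSpace.somePath p₀ p
  rw [abelJacobi_eq_integral hloc hab hP γ, abelJacobi_eq_integral hloc hab hP (γ.trans σ),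
    Path.map_trans, LocalPrimitives.integral_trans]
  ring

variable (hη : ∀ i, IsClosedOneForm I (η i)) {Γ : Module.Basis (Fin b) ℤ (H1 M)}
  (hdual : ∀ i j, HasPeriod I (η i) (Γ j) (if i = j then 1 else 0))

include hη hdual

theorem abelJacobi_sub_eq_repr {p q : Ma} (σ : Path p q) {x : M} {γ : Path x x}
    (hσ : ∀ t, π (σ t) = γ t) {a : H1 M} (ha : Represents γ a) :
    abelJacobi I π η p₀ q - abelJacobi I π η p₀ p = fun i => (Γ.repr a i : ℝ) := by
  choose P hP using fun i => (hη i).exists_localPrimitives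
  funext i
  have hγ : (σ.map π.continuous).toContinuousMap = γ.toContinuousMap := ContinuousMap.ext hσ
  rw [Pi.sub_apply, abelJacobi_sub_eq_integral hloc hab hP σ, hγ, ← (P i).period_eq ha,
    period_eq_repr hP hdual]

theorem exists_abelJacobi_sub_eq {f : C(M, M)} {F : Ma → Ma} (hF : IsLift π f F) {p q : Ma}
    (h : π p = π q) :
    ∃ a : H1 M,
      abelJacobi I π η p₀ q - abelJacobi I π η p₀ p = (fun i => (Γ.repr a i : ℝ)) ∧
      abelJacobi I π η p₀ (F q) - abelJacobi I π η p₀ (F p) =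
        fun i => (Γ.repr (H1map f a) i : ℝ) := by
  let σ := PathConnectedSpace.somePath p q
  let γ : Path (π p) (π p) := (σ.map π.continuous).cast rfl h
  obtain ⟨a, ha⟩ := exists_represents γ
  exact ⟨a, abelJacobi_sub_eq_repr hloc hab hη hdual σ (fun _ => rfl) ha,
    abelJacobi_sub_eq_repr hloc hab hη hdual (σ.map hF.1) (γ := γ.map f.continuous)
      (fun t => hF.2 (σ t)) (ha.map f)⟩

theorem exists_int_abelJacobi_sub {p q : Ma} (h : π p = π q) :
    ∃ n : Fin b → ℤ,
      abelJacobi I π η p₀ q - abelJacobi I π η p₀ p = fun i => (n i : ℝ) := by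
  obtain ⟨a, ha, -⟩ := exists_abelJacobi_sub_eq (p₀ := p₀) hloc hab hη hdual
    (f := ContinuousMap.id M) (F := id) ⟨continuous_id, fun _ => rfl⟩ h
  exact ⟨fun i => Γ.repr a i, ha⟩

theorem abelJacobi_lift_sub {f : C(M, M)} {F : Ma → Ma} (hF : IsLift π f F)
    {A : Matrix (Fin b) (Fin b) ℤ} (hA : LinearMap.toMatrix Γ Γ (H1map f) = A) {p q : Ma}
    (h : π p = π q) :
    abelJacobi I π η p₀ (F q) - abelJacobi I π η p₀ (F p) =
      linAct A (abelJacobi I π η p₀ q - abelJacobi I π η p₀ p) := by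
  obtain ⟨a, ha, hFa⟩ := exists_abelJacobi_sub_eq hloc hab hη hdual hF h
  rw [ha, hFa, ← LinearMap.toMatrix_mulVec_repr Γ Γ, hA]
  ext i
  simp [linAct, Matrix.mulVec, dotProduct]

end AbelJacobi

/-! ### Displacements and shadowing -/

section Torus

variable {b : ℕ} (A : Matrix (Fin b) (Fin b) ℤ) (k : ℕ)

theorem linAct_sub (v w : Fin b → ℝ) : linAct A (v - w) = linAct A v - linAct A w :=
  Matrix.mulVec_sub _ _ _

theorem linAct_intCast (n : Fin b → ℤ) :
    linAct A (fun i => (n i : ℝ)) = fun i => (((A.mulVec n) i : ℤ) : ℝ) := by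
  ext i
  simp [linAct, Matrix.mulVec, dotProduct]

theorem map_intCast_pow_sub_one {R : Type*} [CommRing R] :
    (A ^ k - 1).map (Int.cast : ℤ → R) = A.map (Int.cast : ℤ → R) ^ k - 1 := by
  change (Int.castRingHom R).mapMatrix (A ^ k - 1) = (Int.castRingHom R).mapMatrix A ^ k - 1
  rw [map_sub, map_pow, map_one]

theorem det_map_intCast {R : Type*} [CommRing R] :
    (A.map (Int.cast : ℤ → R)).det = A.det :=
  ((Int.castRingHom R).map_det A).symm

theorem linAct_pow_sub_one (v : Fin b → ℝ) :
    linAct (A ^ k - 1) v = (linAct A)^[k] v - v := by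
  have h (j : ℕ) : (linAct A)^[j] v = (A.map (Int.cast : ℤ → ℝ) ^ j).mulVec v := by
    induction j with
    | zero => simp
    | succ j ih => rw [Function.iterate_succ_apply', ih, linAct, Matrix.mulVec_mulVec, pow_succ']
  rw [h, linAct, map_intCast_pow_sub_one, Matrix.sub_mulVec, Matrix.one_mulVec]

variable {A}

theorem linAct_injective (hA : A.det ≠ 0) : Function.Injective (linAct A) := by
  refine Matrix.mulVec_injective_of_isUnit ((Matrix.isUnit_iff_isUnit_det _).2 ?_)
  rw [det_map_intCast, isUnit_iff_ne_zero]
  exact Int.cast_ne_zero.2 hA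

theorem NoRootOfUnityEigenvalue.det_pow_sub_one_ne_zero (hA : NoRootOfUnityEigenvalue A)
    {k : ℕ} (hk : 0 < k) : (A ^ k - 1).det ≠ 0 := by
  intro hdet
  have hspec : (1 : ℂ) ∈ spectrum ℂ (A.map (Int.cast : ℤ → ℂ) ^ k) := by
    rw [spectrum.mem_iff, map_one, ← IsUnit.neg_iff, neg_sub, ← map_intCast_pow_sub_one,
      Matrix.isUnit_iff_isUnit_det, det_map_intCast, hdet, Int.cast_zero]
    exact not_isUnit_zero
  rw [spectrum.map_pow_of_pos _ hk] at hspec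
  obtain ⟨μ, hμ, hμk⟩ := hspec
  refine hA μ k hk hμk ?_
  rwa [Module.End.hasEigenvalue_iff_mem_spectrum, Matrix.spectrum_toLin']

theorem toralEnd_iterate_torusProj (v : Fin b → ℝ) :
    (toralEnd A)^[k] (torusProj v) = torusProj ((linAct A)^[k] v) :=
  ((Function.Semiconj.iterate_right (fun v => (toralEnd_torusProj A v).symm) k) v).symm

theorem torusProj_eq_iff {v w : Fin b → ℝ} :
    torusProj v = torusProj w ↔ ∃ n : Fin b → ℤ, v - w = fun i => (n i : ℝ) := by
  have h (s t : ℝ) : (s : AddCircle (1 : ℝ)) = t ↔ ∃ n : ℤ, s - t = n := by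
    rw [← sub_eq_zero, ← AddCircle.coe_sub, AddCircle.coe_eq_zero_iff]
    simp [eq_comm]
  simp only [funext_iff, torusProj, h, Pi.sub_apply]
  exact Classical.skolem

variable {k}

theorem exists_int_translation_linAct_iterate {v : Fin b → ℝ}
    (hv : Function.IsPeriodicPt (toralEnd A) k (torusProj v)) :
    ∃ n : Fin b → ℤ, translation id (linAct A)^[k] v = fun i => (n i : ℝ) :=
  torusProj_eq_iff.1 ((toralEnd_iterate_torusProj k v).symm.trans hv)

theorem mk_eq_mk_iff_torusProj_eq (hA : A.det ≠ 0) {n m : Fin b → ℤ} {v w : Fin b → ℝ}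
    (hv : linAct A v = fun i => (n i : ℝ)) (hw : linAct A w = fun i => (m i : ℝ)) :
    Submodule.Quotient.mk (p := LinearMap.range A.mulVecLin) n = Submodule.Quotient.mk m ↔
      torusProj v = torusProj w := by
  rw [Submodule.Quotient.eq, LinearMap.mem_range, torusProj_eq_iff]
  refine exists_congr fun z => ?_
  rw [← (linAct_injective hA).eq_iff, linAct_sub, hv, hw, linAct_intCast, Matrix.mulVecLin_apply,
    eq_comm]
  simp only [funext_iff, Pi.sub_apply]
  exact forall_congr' fun i => by norm_cast

end Torus

section Displacement

variable {b : ℕ} {A : Matrix (Fin b) (Fin b) ℤ} {k : ℕ} (hdet : (A ^ k - 1).det ≠ 0)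
  {X Xa X' Xa' : Type*} {π : Xa → X} {π' : Xa' → X'} {ι : Xa → Fin b → ℝ} {ι' : Xa' → Fin b → ℝ}
  {F : Xa → Xa} {F' : Xa' → Xa'}

theorem displacement_eq_mk {hπ : Function.Surjective π} {x : X} {n : Fin b → ℤ}
    (hn : translation ι F (Function.surjInv hπ x) = fun i => (n i : ℝ)) :
    displacement A k hπ ι F x = Submodule.Quotient.mk n := by
  simp only [displacement, hn, Int.floor_intCast]

include hdet

theorem linAct_alphaLift (p : Xa) :
    linAct (A ^ k - 1) (alphaLift A k ι F p) = translation ι F p := by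
  have hunit : IsUnit ((A ^ k - 1).map (Int.cast : ℤ → ℝ)).det := by
    rw [det_map_intCast, isUnit_iff_ne_zero]
    exact Int.cast_ne_zero.2 hdet
  rw [linAct, alphaLift, ← map_intCast_pow_sub_one, Matrix.mulVec_mulVec,
    Matrix.mul_nonsing_inv _ hunit, Matrix.one_mulVec]

theorem linAct_iterate_alphaLift (p : Xa) :
    (linAct A)^[k] (alphaLift A k ι F p) = alphaLift A k ι F p + translation ι F p := by
  rw [← linAct_alphaLift hdet, linAct_pow_sub_one, add_sub_cancel]

theorem alpha_linAct_iterate (y : Torus b) :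
    alpha A k torusProj_surjective id (linAct A)^[k] y = y := by
  have h (v : Fin b → ℝ) : alphaLift A k id (linAct A)^[k] v = v :=
    linAct_injective hdet <| (linAct_alphaLift hdet v).trans (linAct_pow_sub_one A k v).symm
  rw [alpha, h, Function.surjInv_eq torusProj_surjective]

theorem displacement_eq_displacement_iff {hπ : Function.Surjective π}
    {hπ' : Function.Surjective π'} {x : X} {y : X'}
    (hx : ∃ n : Fin b → ℤ, translation ι F (Function.surjInv hπ x) = fun i => (n i : ℝ))
    (hy : ∃ n : Fin b → ℤ, translation ι' F' (Function.surjInv hπ' y) = fun i => (n i : ℝ)) :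
    displacement A k hπ ι F x = displacement A k hπ' ι' F' y ↔
      alpha A k hπ ι F x = alpha A k hπ' ι' F' y := by
  obtain ⟨n, hn⟩ := hx
  obtain ⟨m, hm⟩ := hy
  rw [displacement_eq_mk hn, displacement_eq_mk hm]
  exact mk_eq_mk_iff_torusProj_eq hdet ((linAct_alphaLift hdet _).trans hn)
    ((linAct_alphaLift hdet _).trans hm)

end Displacement

section Shadowing

variable {b : ℕ} {A : Matrix (Fin b) (Fin b) ℤ} {k : ℕ}

theorem periodic_sub_linAct_iterate {Xa : Type*} {ι : Xa → Fin b → ℝ} {F : Xa → Xa} {p : Xa}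
    (hι : ∀ j, ι (F^[j + 1 + k] p) - ι (F^[j + 1] p) =
      linAct A (ι (F^[j + k] p) - ι (F^[j] p)))
    {v : Fin b → ℝ} (hv : (linAct A)^[k] v = v + translation ι F^[k] p) :
    Function.Periodic (fun j => ι (F^[j] p) - (linAct A)^[j] v) k := by
  intro j
  rw [← sub_eq_zero, sub_sub_sub_comm, sub_eq_zero]
  induction j with
  | zero => simp [hv, translation]
  | succ j ih =>
    rw [hι, ih, linAct_sub, ← Function.iterate_succ_apply' (linAct A),
      ← Function.iterate_succ_apply' (linAct A), Nat.succ_eq_add_one, add_right_comm]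

theorem shadow_of_periodic {Xa : Type*} {ι : Xa → Fin b → ℝ} {F : Xa → Xa} {p : Xa}
    {v : Fin b → ℝ} (hk : 0 < k)
    (h : Function.Periodic (fun j => ι (F^[j] p) - (linAct A)^[j] v) k) : Shadow A ι F p v := by
  let d (j : ℕ) : ℝ := dist (WithLp.toLp 2 (ι (F^[j] p))) (WithLp.toLp 2 ((linAct A)^[j] v))
  have hd : Function.Periodic d k := fun j => by
    simp only [d, dist_eq_norm, ← WithLp.toLp_sub]
    exact congrArg (fun w => ‖WithLp.toLp 2 w‖) (h j)
  refine ⟨∑ r ∈ Finset.range k, d r, fun j => ?_⟩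
  change d j ≤ _
  rw [← hd.map_mod_nat j]
  exact Finset.single_le_sum (f := d) (fun _ _ => dist_nonneg)
    (Finset.mem_range.2 (Nat.mod_lt j hk))

variable {X Xa : Type*} [TopologicalSpace X] [TopologicalSpace Xa] {π : C(Xa, X)} {f : C(X, X)}
  {F : Xa → Xa}

theorem IsLift.map_iterate (hF : IsLift π f F) (j : ℕ) (p : Xa) : π (F^[j] p) = f^[j] (π p) :=
  Function.Semiconj.iterate_right (ga := F) (gb := f) hF.2 j p

theorem globallyShadow_alpha (hπ : Function.Surjective π) {ι : Xa → Fin b → ℝ} (hF : IsLift π f F)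
    (hι : ∀ p q, π p = π q → ι (F q) - ι (F p) = linAct A (ι q - ι p))
    (hdet : (A ^ k - 1).det ≠ 0) (hk : 0 < k) {x : X} (hx : Function.IsPeriodicPt f k x) :
    GloballyShadow A π ι f x (alpha A k hπ ι F^[k] x) := by
  let p := Function.surjInv hπ x
  have hp : π p = x := Function.surjInv_eq hπ x
  have hfib (j : ℕ) : π (F^[j] p) = π (F^[j + k] p) := by
    rw [hF.map_iterate, hF.map_iterate, hp, Function.iterate_add_apply, hx]
  refine ⟨F, p, _, hF, hp, rfl, shadow_of_periodic hk <|
    periodic_sub_linAct_iterate (fun j => ?_) (linAct_iterate_alphaLift hdet p)⟩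
  rw [add_right_comm, Function.iterate_succ_apply', Function.iterate_succ_apply']
  exact hι _ _ (hfib j)

end Shadowing

end GlobalShadow

open GlobalShadow in
theorem mainTheorem8_general
    {E : Type*} [NormedAddCommGroup E] [NormedSpace ℝ E]
    {H : Type*} [TopologicalSpace H] (I : ModelWithCorners ℝ E H)
    {M : Type u} [TopologicalSpace M] [ChartedSpace H M] [IsManifold I ∞ M]
    {b : ℕ} (Γ : Module.Basis (Fin b) ℤ (H1 M))
    (η : Fin b → ∀ x : M, TangentSpace I x →L[ℝ] ℝ) (hη : ∀ i, IsClosedOneForm I (η i))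
    (hdual : ∀ i j, HasPeriod I (η i) (Γ j) (if i = j then 1 else 0))
    {Ma : Type*} [TopologicalSpace Ma] [PathConnectedSpace Ma] (π : C(Ma, M))
    (hloc : IsLocalHomeomorph π) (hsurj : Function.Surjective π) (p₀ : Ma)
    (hab : (FundamentalGroup.map π p₀).range ≤ commutator (FundamentalGroup M (π p₀)))
    (f : C(M, M)) (A : Matrix (Fin b) (Fin b) ℤ)
    (hA : LinearMap.toMatrix Γ Γ (H1map f) = A) (F : Ma → Ma) (hF : IsLift π f F)
    (k : ℕ) (hk : 0 < k) (hdet : (A ^ k - 1).det ≠ 0)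
    (x : M) (hx : Function.IsPeriodicPt f k x)
    (y : Torus b) (hy : Function.IsPeriodicPt (toralEnd A) k y) :
    (displacement A k hsurj (abelJacobi I π η p₀) F^[k] x =
        displacement A k torusProj_surjective id (linAct A)^[k] y ↔
      alpha A k hsurj (abelJacobi I π η p₀) F^[k] x = y) ∧
    (displacement A k hsurj (abelJacobi I π η p₀) F^[k] x =
        displacement A k torusProj_surjective id (linAct A)^[k] y →
      GloballyShadow A π (abelJacobi I π η p₀) f x y) := by
  have hfib : π (Function.surjInv hsurj x) = π (F^[k] (Function.surjInv hsurj x)) := by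
    rw [hF.map_iterate, Function.surjInv_eq hsurj, hx]
  have hn := exists_int_abelJacobi_sub hloc hab hη hdual hfib
  have hm := exists_int_translation_linAct_iterate (v := Function.surjInv torusProj_surjective y)
    (by rwa [Function.surjInv_eq torusProj_surjective])
  have hiff := displacement_eq_displacement_iff hdet hn hm
  rw [alpha_linAct_iterate hdet] at hiff
  refine ⟨hiff, fun h => ?_⟩
  rw [← hiff.1 h]
  exact globallyShadow_alpha hsurj hF
    (fun p q => abelJacobi_lift_sub hloc hab hη hdual hF hA) hdet hk hx

theorem mainTheorem8
    {E : Type*} [NormedAddCommGroup E] [NormedSpace ℝ E] [FiniteDimensional ℝ E]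
    {H : Type*} [TopologicalSpace H] (I : ModelWithCorners ℝ E H)
    {M : Type u} [TopologicalSpace M] [ChartedSpace H M] [IsManifold I ∞ M]
    [CompactSpace M] [ConnectedSpace M] [T2Space M]
    {b : ℕ} (Γ : Module.Basis (Fin b) ℤ (GlobalShadow.H1 M))
    (η : Fin b → ∀ x : M, TangentSpace I x →L[ℝ] ℝ)
    (hη : ∀ i, GlobalShadow.IsClosedOneForm I (η i))
    (hdual : ∀ i j, GlobalShadow.HasPeriod I (η i) (Γ j) (if i = j then 1 else 0))
    {Ma : Type*} [TopologicalSpace Ma] (π : C(Ma, M))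
    (hπ : GlobalShadow.IsUniversalAbelianCover π) (p₀ : Ma)
    (f : C(M, M)) (A : Matrix (Fin b) (Fin b) ℤ)
    (hA : LinearMap.toMatrix Γ Γ (GlobalShadow.H1map f) = A)
    (hroot : GlobalShadow.NoRootOfUnityEigenvalue A)
    (F : Ma → Ma) (hF : GlobalShadow.IsLift π f F)
    (k : ℕ) (hk : 0 < k)
    (x : M) (hx : Function.IsPeriodicPt f k x)
    (y : GlobalShadow.Torus b) (hy : Function.IsPeriodicPt (GlobalShadow.toralEnd A) k y) :
    (GlobalShadow.displacement A k hπ.surjective (GlobalShadow.abelJacobi I π η p₀) F^[k] x =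
        GlobalShadow.displacement A k GlobalShadow.torusProj_surjective id
          (GlobalShadow.linAct A)^[k] y ↔
      GlobalShadow.alpha A k hπ.surjective (GlobalShadow.abelJacobi I π η p₀) F^[k] x = y) ∧
    (GlobalShadow.displacement A k hπ.surjective (GlobalShadow.abelJacobi I π η p₀) F^[k] x =
        GlobalShadow.displacement A k GlobalShadow.torusProj_surjective id
          (GlobalShadow.linAct A)^[k] y →
      GlobalShadow.GloballyShadow A π (GlobalShadow.abelJacobi I π η p₀) f x y) := by
  have := hπ.pathConnected
  exact mainTheorem8_general I Γ η hη hdual π hπ.isCoveringMap.isLocalHomeomorph hπ.surjective p₀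
    (hπ.range_eq p₀).le f A hA F hF k hk (hroot.det_pow_sub_one_ne_zero hk) x hx y hy
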